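/- Let $n, d$ be integers with $n \ge 16$ and $d/n \le 16$, let $\mu \in \mathbb{R}^d$, and let $t \ge 5$ be real. Let $X$ be a random $n \times d$ matrix whose rows $X_1, \dots, X_n$ are independent, each with the Gaussian law $\mathcal{N}(\mu, I_d)$. Let $\bar\mu = \frac1n \sum_{i=1}^n X_i$ be the sample mean and let $\Sigma = \frac1n \sum_{i=1}^n (X_i - \bar\mu)^T (X_i - \bar\mu)$ (with the $X_i$ written as row vectors) be the $d \times d$ sample covariance matrix, i.e. $\Sigma = \frac1n Z^T Z$, where $Z$ is $X$ with $\bar\mu$ subtracted from each row. Then, with probability at least $1 - 3\exp(-t^2/8)$, $$\|\Sigma\|_2 \le \left(1 + \sqrt{d/n} + t/\sqrt{n}\right)^2,$$ where $\|\cdot\|_2$ is the spectral (operator) norm. -/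

import Mathlib

open MeasureTheory ProbabilityTheory
-- The norm `‖A‖` of a real matrix is its spectral norm (the `ℓ²` operator norm).
open scoped Matrix.Norms.L2Operator

noncomputable section

/-- The mean of the rows of an `n × d` data matrix, `(1/n) ∑ᵢ Xᵢ`. -/
def sampleMean {n d : ℕ} (X : Matrix (Fin n) (Fin d) ℝ) : Fin d → ℝ :=
  (1 / (n : ℝ)) • ∑ i, X.row i

/-- The data matrix with the sample mean subtracted from each of its rows. -/
def centeredData {n d : ℕ} (X : Matrix (Fin n) (Fin d) ℝ) : Matrix (Fin n) (Fin d) ℝ :=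
  Matrix.of fun i => X.row i - sampleMean X

/-- The sample covariance matrix `(1/n) (X - μ̄)ᵀ (X - μ̄)`, normalized by `n`. -/
def sampleCovariance {n d : ℕ} (X : Matrix (Fin n) (Fin d) ℝ) : Matrix (Fin d) (Fin d) ℝ :=
  (1 / (n : ℝ)) • ((centeredData X).transpose * centeredData X)

end

/-! Centering is an orthogonal projection of the columns and removes μ, so with G = X − μ, a matrix
of independent standard normals, ‖Σ‖ ≤ ‖G‖²/n. It suffices to show that ‖G‖ > √n + √d + t has
probability at most 3 exp(−t²/8).

The norm ‖G‖ is the supremum of uᵀGv over unit vectors. Adding an independent standard normal γ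
gives it the same variances as ⟨g, u⟩ + ⟨h, v⟩ and covariances at least as large, the difference
being (1 − ⟨u, u'⟩)(1 − ⟨v, v'⟩). By Slepian's inequality, large values of uᵀGv + γ are no more
likely than large values of ⟨g, u⟩ + ⟨h, v⟩ ≤ |g| + |h|. Conditioning on γ ≥ 0 costs a factor 2
(`measureReal_exists_bilin_le`).

A Chernoff bound gives P(|g| + |h| > √n + √d + s) ≤ exp(−s²/4) (`measureReal_lt_sqrt_add_sqrt_le`).
Slepian is applied with a smooth cut-off of width 1, so s = t − 1, and 2 exp(−(t−1)²/4) ≤ 3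
exp(−t²/8). -/

section GaussianMatrix

open Matrix

/-! ### Gaussian integration by parts -/

/-- The law of a family of independent standard normal variables. -/
noncomputable abbrev piGaussian (κ : Type*) [Fintype κ] : Measure (κ → ℝ) :=
  Measure.pi fun _ : κ => gaussianReal 0 1

/-- Resampling one coordinate gives Fubini in that coordinate without splitting the index type. It
is checked on boxes. -/
lemma measurePreserving_update_pi {κ : Type*} [Fintype κ] [DecidableEq κ] (k : κ)
    (ν : κ → Measure ℝ) [∀ i, IsProbabilityMeasure (ν i)] :
    MeasurePreserving (fun p : (κ → ℝ) × ℝ => Function.update p.1 k p.2)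
      ((Measure.pi ν).prod (ν k)) (Measure.pi ν) := by
  have hm : Measurable (fun p : (κ → ℝ) × ℝ => Function.update p.1 k p.2) := by
    rw [measurable_pi_iff]
    intro i
    by_cases h : i = k
    · subst h; simpa using measurable_snd
    · simp only [Function.update_of_ne h]; fun_prop
  refine ⟨hm, (Measure.pi_eq fun s hs => ?_).symm⟩
  rw [Measure.map_apply hm (MeasurableSet.univ_pi hs)]
  have : (fun p : (κ → ℝ) × ℝ => Function.update p.1 k p.2) ⁻¹' (Set.univ.pi s) =
      (Set.univ.pi (Function.update s k Set.univ)) ×ˢ s k := by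
    ext p
    simp only [Set.mem_preimage, Set.mem_pi, Set.mem_univ, true_imp_iff, Set.mem_prod]
    constructor
    · refine fun h => ⟨fun i => ?_, by simpa using h k⟩
      by_cases hi : i = k
      · subst hi; simp
      · simpa [hi] using h i
    · rintro ⟨h, h'⟩ i
      by_cases hi : i = k
      · subst hi; simpa using h'
      · simpa [hi] using h i
  rw [this, Measure.prod_prod, Measure.pi_pi,
    ← Finset.mul_prod_erase Finset.univ (fun i => ν i (s i)) (Finset.mem_univ k),
    ← Finset.mul_prod_erase Finset.univ _ (Finset.mem_univ k), mul_comm]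
  simp only [Function.update_self, measure_univ, one_mul]
  congr 1
  refine Finset.prod_congr rfl fun i hi => ?_
  rw [Function.update_of_ne (Finset.ne_of_mem_erase hi)]

lemma hasDerivAt_gaussianPDFReal (y : ℝ) :
    HasDerivAt (gaussianPDFReal 0 1) (-(y * gaussianPDFReal 0 1 y)) y := by
  have h : HasDerivAt (fun x : ℝ => (√(2 * Real.pi * ((1 : NNReal) : ℝ)))⁻¹ *
      Real.exp (-(x - 0) ^ 2 / (2 * ((1 : NNReal) : ℝ))))
      ((√(2 * Real.pi * ((1 : NNReal) : ℝ)))⁻¹ *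
        (Real.exp (-(y - 0) ^ 2 / (2 * ((1 : NNReal) : ℝ))) *
          (-(2 * (y - 0)) / (2 * ((1 : NNReal) : ℝ))))) y := by
    refine HasDerivAt.const_mul _ (HasDerivAt.exp ?_)
    refine HasDerivAt.div_const ?_ _
    simpa using (((hasDerivAt_id y).sub_const 0).fun_pow 2).fun_neg
  convert h using 1
  · exact gaussianPDFReal_def 0 1
  · rw [gaussianPDFReal, NNReal.coe_one]
    ring

lemma integrable_id_mul_of_bounded {g : ℝ → ℝ} {C : ℝ} (hg : Continuous g)
    (hC : ∀ y, |g y| ≤ C) : Integrable (fun y => y * g y) (gaussianReal 0 1) := by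
  refine Integrable.mul_bdd (c := C) ?_ hg.aestronglyMeasurable (.of_forall hC)
  exact (memLp_id_gaussianReal (μ := 0) (v := 1) 1).integrable (by simp)

/-- Stein's identity for the standard normal law. -/
lemma integral_id_mul_gaussianReal {g g' : ℝ → ℝ} {C C' : ℝ} (hd : ∀ y, HasDerivAt g (g' y) y)
    (hg' : Continuous g') (hC : ∀ y, |g y| ≤ C) (hC' : ∀ y, |g' y| ≤ C') :
    ∫ y, y * g y ∂gaussianReal 0 1 = ∫ y, g' y ∂gaussianReal 0 1 := by
  have hg : Continuous g := continuous_iff_continuousAt.2 fun y => (hd y).continuousAt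
  have hi := integrable_id_mul_of_bounded hg hC
  have hv : (1 : NNReal) ≠ 0 := one_ne_zero
  -- The density φ satisfies φ' = −yφ, so Stein's identity is integration by parts against φ;
  -- integrability removes the boundary terms.
  have h := integral_mul_deriv_eq_deriv_mul_of_integrable (u := g) (v := gaussianPDFReal 0 1)
    (u' := g') (v' := fun y => -(y * gaussianPDFReal 0 1 y)) (fun y _ => hd y)
    (fun y _ => hasDerivAt_gaussianPDFReal y) ?_ ?_ ?_
  · rw [integral_gaussianReal_eq_integral_smul hv, integral_gaussianReal_eq_integral_smul hv]
    simp only [smul_eq_mul]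
    rw [← neg_inj, ← integral_neg]
    simp only [mul_comm (gaussianPDFReal 0 1 _) (g' _)]
    rw [← h]
    congr 1
    ext y
    ring
  · rw [gaussianReal_of_var_ne_zero _ hv, integrable_withDensity_iff_integrable_smul'
      (measurable_gaussianPDF _ _) (.of_forall fun _ => gaussianPDF_lt_top)] at hi
    refine hi.neg.congr (.of_forall fun y => ?_)
    simp only [toReal_gaussianPDF, smul_eq_mul, Pi.neg_apply, Pi.mul_apply]
    ring
  · exact (integrable_gaussianPDFReal 0 1).bdd_mul (c := C') hg'.aestronglyMeasurable
      (.of_forall hC')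
  · exact (integrable_gaussianPDFReal 0 1).bdd_mul (c := C) hg.aestronglyMeasurable
      (.of_forall hC)

lemma integrable_eval_piGaussian {κ : Type*} [Fintype κ] (k : κ) :
    Integrable (fun x : κ → ℝ => x k) (piGaussian κ) :=
  integrable_eval (μ := fun _ : κ => gaussianReal 0 1) (i := k)
    ((memLp_id_gaussianReal (μ := 0) (v := 1) 1).integrable (by simp))

/-- Gaussian integration by parts in the coordinate `k`. -/
lemma integral_eval_mul_piGaussian {κ : Type*} [Fintype κ] [DecidableEq κ] (k : κ)
    {h h' : (κ → ℝ) → ℝ} {C C' : ℝ}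
    (hd : ∀ x y, HasDerivAt (fun y => h (Function.update x k y)) (h' (Function.update x k y)) y)
    (hc : Continuous h) (hc' : Continuous h') (hC : ∀ x, |h x| ≤ C) (hC' : ∀ x, |h' x| ≤ C') :
    ∫ x, x k * h x ∂piGaussian κ = ∫ x, h' x ∂piGaussian κ := by
  have hmp := measurePreserving_update_pi k fun _ : κ => gaussianReal 0 1
  have h1 : Integrable (fun x : κ → ℝ => x k * h x) (piGaussian κ) :=
    (integrable_eval_piGaussian k).mul_bdd (c := C) hc.aestronglyMeasurable (.of_forall hC)
  have h2 : Integrable h' (piGaussian κ) :=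
    .of_bound hc'.aestronglyMeasurable C' (.of_forall hC')
  have key : ∀ F : (κ → ℝ) → ℝ, Integrable F (piGaussian κ) → ∫ x, F x ∂piGaussian κ =
      ∫ x, ∫ y, F (Function.update x k y) ∂gaussianReal 0 1 ∂piGaussian κ := by
    intro F hF
    rw [← integral_prod (fun p : (κ → ℝ) × ℝ => F (Function.update p.1 k p.2))
      (hmp.integrable_comp_of_integrable hF), ← integral_map hmp.measurable.aemeasurable
      (by rw [hmp.map_eq]; exact hF.1), hmp.map_eq]
  rw [key _ h1, key _ h2]
  congr 1
  ext x
  simp only [Function.update_self]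
  exact integral_id_mul_gaussianReal (hd x) (by fun_prop) (fun _ => hC _) (fun _ => hC' _)

/-! ### Slepian's interpolation for smooth cut-offs -/

lemma hasDerivAt_dotProduct_update {κ : Type*} [Fintype κ] [DecidableEq κ] (v x : κ → ℝ) (k : κ)
    (y : ℝ) : HasDerivAt (fun y => v ⬝ᵥ Function.update x k y) (v k) y := by
  have h : ∀ y, v ⬝ᵥ Function.update x k y = v k * y + ∑ j ∈ Finset.univ.erase k, v j * x j := by
    intro y
    rw [dotProduct, ← Finset.add_sum_erase _ _ (Finset.mem_univ k), Function.update_self]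
    congr 1
    refine Finset.sum_congr rfl fun j hj => ?_
    rw [Function.update_of_ne (Finset.ne_of_mem_erase hj)]
  simp only [h]
  simpa using (HasDerivAt.const_mul (v k) (hasDerivAt_id' y)).add_const
    (∑ j ∈ Finset.univ.erase k, v j * x j)

/-- `ψ` decreases from values at most `1` to nonnegative values and has the bounded continuous
derivatives `ψ'` and `ψ''`. -/
structure IsSmoothDescent (ψ ψ' ψ'' : ℝ → ℝ) (C : ℝ) : Prop where
  hasDerivAt : ∀ x, HasDerivAt ψ (ψ' x) x
  hasDerivAt' : ∀ x, HasDerivAt ψ' (ψ'' x) x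
  continuous'' : Continuous ψ''
  nonneg : ∀ x, 0 ≤ ψ x
  le_one : ∀ x, ψ x ≤ 1
  deriv_nonpos : ∀ x, ψ' x ≤ 0
  abs_deriv_le : ∀ x, |ψ' x| ≤ C
  abs_deriv2_le : ∀ x, |ψ'' x| ≤ C

namespace IsSmoothDescent

variable {ψ ψ' ψ'' : ℝ → ℝ} {C : ℝ}

lemma continuous (h : IsSmoothDescent ψ ψ' ψ'' C) : Continuous ψ :=
  continuous_iff_continuousAt.2 fun x => (h.hasDerivAt x).continuousAt

lemma continuous' (h : IsSmoothDescent ψ ψ' ψ'' C) : Continuous ψ' :=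
  continuous_iff_continuousAt.2 fun x => (h.hasDerivAt' x).continuousAt

lemma bound_nonneg (h : IsSmoothDescent ψ ψ' ψ'' C) : 0 ≤ C :=
  (abs_nonneg _).trans (h.abs_deriv_le 0)

lemma prod_nonneg (h : IsSmoothDescent ψ ψ' ψ'' C) {ι : Type*} (u : Finset ι) (z : ι → ℝ) :
    0 ≤ ∏ j ∈ u, ψ (z j) := Finset.prod_nonneg fun _ _ => h.nonneg _

lemma prod_le_one (h : IsSmoothDescent ψ ψ' ψ'' C) {ι : Type*} (u : Finset ι) (z : ι → ℝ) :
    ∏ j ∈ u, ψ (z j) ≤ 1 := Finset.prod_le_one (fun _ _ => h.nonneg _) fun _ _ => h.le_one _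

lemma abs_prod_le_one (h : IsSmoothDescent ψ ψ' ψ'' C) {ι : Type*} (u : Finset ι) (z : ι → ℝ) :
    |∏ j ∈ u, ψ (z j)| ≤ 1 := by
  rw [abs_of_nonneg (h.prod_nonneg u z)]; exact h.prod_le_one u z

/-- Gaussian integration by parts for a partial derivative of `x ↦ ∏ i, ψ ⟨c i, x⟩`. -/
lemma integral_dotProduct_mul (h : IsSmoothDescent ψ ψ' ψ'' C) {ι κ : Type*} [Fintype ι]
    [DecidableEq ι] [Fintype κ] (c : ι → κ → ℝ) (i : ι) (w : κ → ℝ) :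
    ∫ x, (w ⬝ᵥ x) * (ψ' (c i ⬝ᵥ x) * ∏ j ∈ Finset.univ.erase i, ψ (c j ⬝ᵥ x)) ∂piGaussian κ =
      (w ⬝ᵥ c i) * ∫ x, ψ'' (c i ⬝ᵥ x) * ∏ j ∈ Finset.univ.erase i, ψ (c j ⬝ᵥ x) ∂piGaussian κ +
      ∑ j ∈ Finset.univ.erase i, (w ⬝ᵥ c j) * ∫ x, ψ' (c i ⬝ᵥ x) *
        ((∏ l ∈ (Finset.univ.erase i).erase j, ψ (c l ⬝ᵥ x)) * ψ' (c j ⬝ᵥ x)) ∂piGaussian κ := by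
  classical
  have hψ := h.continuous
  have hψ' := h.continuous'
  have hψ'' := h.continuous''
  have hC := h.bound_nonneg
  set A : (κ → ℝ) → ℝ := fun x => ψ'' (c i ⬝ᵥ x) * ∏ j ∈ Finset.univ.erase i, ψ (c j ⬝ᵥ x)
  set B : ι → (κ → ℝ) → ℝ := fun j x => ψ' (c i ⬝ᵥ x) *
    ((∏ l ∈ (Finset.univ.erase i).erase j, ψ (c l ⬝ᵥ x)) * ψ' (c j ⬝ᵥ x))
  set H : (κ → ℝ) → ℝ := fun x => ψ' (c i ⬝ᵥ x) * ∏ j ∈ Finset.univ.erase i, ψ (c j ⬝ᵥ x)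
  have hcA : Continuous A := by fun_prop
  have hcB : ∀ j, Continuous (B j) := fun j => by fun_prop
  have hcH : Continuous H := by fun_prop
  have hA : ∀ x, |A x| ≤ C := fun x => by
    rw [abs_mul]
    exact (mul_le_mul (h.abs_deriv2_le _) (h.abs_prod_le_one _ _) (abs_nonneg _) hC).trans_eq
      (mul_one C)
  have hH : ∀ x, |H x| ≤ C := fun x => by
    rw [abs_mul]
    exact (mul_le_mul (h.abs_deriv_le _) (h.abs_prod_le_one _ _) (abs_nonneg _) hC).trans_eq
      (mul_one C)
  have hB : ∀ j x, |B j x| ≤ C * C := fun j x => by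
    rw [abs_mul, abs_mul]
    refine mul_le_mul (h.abs_deriv_le _) ?_ (by positivity) hC
    exact (mul_le_mul (h.abs_prod_le_one _ _) (h.abs_deriv_le _) (abs_nonneg _)
      zero_le_one).trans_eq (one_mul C)
  have iA : Integrable A (piGaussian κ) :=
    .of_bound hcA.aestronglyMeasurable C (.of_forall hA)
  have iB : ∀ j, Integrable (B j) (piGaussian κ) := fun j =>
    .of_bound (hcB j).aestronglyMeasurable (C * C) (.of_forall (hB j))
  have step : ∀ k, ∫ x, x k * H x ∂piGaussian κ =
      ∫ x, (c i k * A x + ∑ j ∈ Finset.univ.erase i, c j k * B j x) ∂piGaussian κ := by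
    intro k
    refine integral_eval_mul_piGaussian k (C := C)
      (C' := |c i k| * C + ∑ j ∈ Finset.univ.erase i, |c j k| * (C * C)) ?_ hcH (by fun_prop)
      hH ?_
    · intro x y
      have h1 := (h.hasDerivAt' _).comp y (hasDerivAt_dotProduct_update (c i) x k y)
      have h2 := HasDerivAt.fun_finsetProd (u := Finset.univ.erase i) (fun j _ =>
        (h.hasDerivAt _).comp y (hasDerivAt_dotProduct_update (c j) x k y))
      refine (h1.mul h2).congr_deriv (Eq.symm ?_)
      simp only [A, B, Function.comp_def, smul_eq_mul, Finset.mul_sum]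
      congr 1
      · ring
      · exact Finset.sum_congr rfl fun j _ => by ring
    · intro x
      refine (abs_add_le _ _).trans (add_le_add ?_ ((Finset.abs_sum_le_sum_abs _ _).trans
        (Finset.sum_le_sum fun j _ => ?_)))
      · rw [abs_mul]; exact mul_le_mul_of_nonneg_left (hA x) (abs_nonneg _)
      · rw [abs_mul]; exact mul_le_mul_of_nonneg_left (hB j x) (abs_nonneg _)
  have hI : ∀ k, Integrable (fun x : κ → ℝ => x k * H x) (piGaussian κ) := fun k =>
    (integrable_eval_piGaussian k).mul_bdd (c := C) hcH.aestronglyMeasurable (.of_forall hH)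
  calc ∫ x, (w ⬝ᵥ x) * H x ∂piGaussian κ
      = ∫ x, ∑ k, w k * (x k * H x) ∂piGaussian κ := by
        simp only [dotProduct, Finset.sum_mul, mul_assoc]
    _ = ∑ k, w k * ∫ x, x k * H x ∂piGaussian κ := by
        rw [integral_finsetSum _ fun k _ => (hI k).const_mul _]
        simp only [integral_const_mul]
    _ = ∑ k, w k * (c i k * ∫ x, A x ∂piGaussian κ +
          ∑ j ∈ Finset.univ.erase i, c j k * ∫ x, B j x ∂piGaussian κ) := by
        refine Finset.sum_congr rfl fun k _ => ?_
        rw [step, integral_add (iA.const_mul _)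
          (integrable_finsetSum _ fun j _ => (iB j).const_mul _),
          integral_finsetSum _ fun j _ => (iB j).const_mul _]
        simp only [integral_const_mul]
    _ = (w ⬝ᵥ c i) * ∫ x, A x ∂piGaussian κ +
          ∑ j ∈ Finset.univ.erase i, (w ⬝ᵥ c j) * ∫ x, B j x ∂piGaussian κ := by
        simp only [mul_add, Finset.sum_add_distrib, Finset.mul_sum, dotProduct, Finset.sum_mul]
        rw [Finset.sum_comm]
        simp only [mul_assoc]

/-- Slepian's comparison along the path `cos θ • a + sin θ • b`. -/
lemma integral_prod_le_of_dotProduct_le (h : IsSmoothDescent ψ ψ' ψ'' C) {ι κ : Type*}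
    [Fintype ι] [Fintype κ] (a b : ι → κ → ℝ) (hab : ∀ i j, a i ⬝ᵥ b j = 0)
    (heq : ∀ i, a i ⬝ᵥ a i = b i ⬝ᵥ b i) (hle : ∀ i j, b i ⬝ᵥ b j ≤ a i ⬝ᵥ a j) :
    ∫ x, ∏ i, ψ (b i ⬝ᵥ x) ∂piGaussian κ ≤ ∫ x, ∏ i, ψ (a i ⬝ᵥ x) ∂piGaussian κ := by
  classical
  have hψ := h.continuous
  have hψ' := h.continuous'
  have hC := h.bound_nonneg
  set c : ℝ → ι → κ → ℝ := fun θ i => Real.cos θ • a i + Real.sin θ • b i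
  set c' : ℝ → ι → κ → ℝ := fun θ i => -Real.sin θ • a i + Real.cos θ • b i
  set F : ℝ → (κ → ℝ) → ℝ := fun θ x => ∏ i, ψ (c θ i ⬝ᵥ x)
  set F' : ℝ → (κ → ℝ) → ℝ := fun θ x => ∑ i, (c' θ i ⬝ᵥ x) *
    (ψ' (c θ i ⬝ᵥ x) * ∏ j ∈ Finset.univ.erase i, ψ (c θ j ⬝ᵥ x))
  have hlin : ∀ θ i x, HasDerivAt (fun θ => c θ i ⬝ᵥ x) (c' θ i ⬝ᵥ x) θ := by
    intro θ i x
    simp only [c, c', add_dotProduct, smul_dotProduct, smul_eq_mul]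
    exact ((Real.hasDerivAt_cos θ).mul_const _).add ((Real.hasDerivAt_sin θ).mul_const _)
  have hF : ∀ θ x, HasDerivAt (fun θ => F θ x) (F' θ x) θ := by
    intro θ x
    have h2 := HasDerivAt.fun_finsetProd (u := Finset.univ) (fun j (_ : j ∈ Finset.univ) =>
        (h.hasDerivAt _).comp θ (hlin θ j x))
    refine h2.congr_deriv (Eq.symm ?_)
    simp only [F', Function.comp_def, smul_eq_mul]
    exact Finset.sum_congr rfl fun i _ => by ring
  have hcF : ∀ θ, Continuous (F θ) := fun θ => by fun_prop
  have hcH : ∀ θ i, Continuous fun x : κ → ℝ =>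
      ψ' (c θ i ⬝ᵥ x) * ∏ j ∈ Finset.univ.erase i, ψ (c θ j ⬝ᵥ x) := fun θ i => by fun_prop
  have hH : ∀ θ i (x : κ → ℝ),
      |ψ' (c θ i ⬝ᵥ x) * ∏ j ∈ Finset.univ.erase i, ψ (c θ j ⬝ᵥ x)| ≤ C := fun θ i x => by
    rw [abs_mul]
    exact (mul_le_mul (h.abs_deriv_le _) (h.abs_prod_le_one _ _) (abs_nonneg _) hC).trans_eq
      (mul_one C)
  have hcF' : ∀ θ, Continuous (F' θ) := fun θ => by
    have := hcH θ
    fun_prop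
  have hdot : ∀ v : κ → ℝ, Integrable (fun x => v ⬝ᵥ x) (piGaussian κ) := fun v =>
    integrable_finsetSum _ fun k _ => (integrable_eval_piGaussian k).const_mul _
  -- A majorant independent of θ, for differentiating under the integral.
  have hbound : ∀ θ x, ‖F' θ x‖ ≤ ∑ i, (|a i ⬝ᵥ x| + |b i ⬝ᵥ x|) * C := by
    intro θ x
    refine (norm_sum_le _ _).trans (Finset.sum_le_sum fun i _ => ?_)
    rw [Real.norm_eq_abs, abs_mul]
    refine mul_le_mul ?_ (hH θ i x) (abs_nonneg _) (by positivity)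
    simp only [c', add_dotProduct, smul_dotProduct, smul_eq_mul]
    refine (abs_add_le _ _).trans (add_le_add ?_ ?_)
    · rw [abs_mul, abs_neg]
      exact mul_le_of_le_one_left (abs_nonneg _) (Real.abs_sin_le_one θ)
    · rw [abs_mul]
      exact mul_le_of_le_one_left (abs_nonneg _) (Real.abs_cos_le_one θ)
  have hφ : ∀ θ, HasDerivAt (fun θ => ∫ x, F θ x ∂piGaussian κ) (∫ x, F' θ x ∂piGaussian κ) θ := by
    intro θ
    refine (hasDerivAt_integral_of_dominated_loc_of_deriv_le (s := Set.univ)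
      (bound := fun x => ∑ i, (|a i ⬝ᵥ x| + |b i ⬝ᵥ x|) * C) Filter.univ_mem
      (.of_forall fun θ => (hcF θ).aestronglyMeasurable) ?_ (hcF' θ).aestronglyMeasurable
      (.of_forall fun x θ _ => hbound θ x) ?_ (.of_forall fun x θ _ => hF θ x)).2
    · exact .of_bound (hcF θ).aestronglyMeasurable 1 (.of_forall fun x => h.abs_prod_le_one _ _)
    · exact integrable_finsetSum _ fun i _ => (((hdot _).abs.add (hdot _).abs).mul_const _)
  -- Since a ⊥ b, the covariance of the velocity with the position is half the θ-derivative of the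
  -- covariance along the path.
  have hdd : ∀ θ i j, c' θ i ⬝ᵥ c θ j =
      Real.sin θ * Real.cos θ * (b i ⬝ᵥ b j - a i ⬝ᵥ a j) := by
    intro θ i j
    simp only [c, c', add_dotProduct, dotProduct_add, smul_dotProduct, dotProduct_smul,
      smul_eq_mul, hab, dotProduct_comm (b i) (a j)]
    ring
  have hneg : ∀ θ, 0 ≤ Real.sin θ * Real.cos θ → ∫ x, F' θ x ∂piGaussian κ ≤ 0 := by
    intro θ hθ
    have hI : ∀ i, Integrable (fun x : κ → ℝ => (c' θ i ⬝ᵥ x) *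
        (ψ' (c θ i ⬝ᵥ x) * ∏ j ∈ Finset.univ.erase i, ψ (c θ j ⬝ᵥ x))) (piGaussian κ) := fun i =>
      (hdot _).mul_bdd (c := C) (hcH θ i).aestronglyMeasurable (.of_forall (hH θ i))
    rw [integral_finsetSum _ fun i _ => hI i]
    refine Finset.sum_nonpos fun i _ => ?_
    -- Equal variances kill the diagonal term with ψ''. The remaining terms pair a nonpositive
    -- covariance rate with a product of two factors ψ' ≤ 0, which is nonnegative.
    rw [h.integral_dotProduct_mul (c θ) i (c' θ i), hdd, heq, sub_self, mul_zero, zero_mul,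
      zero_add]
    refine Finset.sum_nonpos fun j _ => mul_nonpos_of_nonpos_of_nonneg ?_ ?_
    · rw [hdd]
      exact mul_nonpos_of_nonneg_of_nonpos hθ (sub_nonpos.2 (hle i j))
    · refine integral_nonneg fun x => ?_
      exact mul_nonneg_of_nonpos_of_nonpos (h.deriv_nonpos _)
        (mul_nonpos_of_nonneg_of_nonpos (h.prod_nonneg _ _) (h.deriv_nonpos _))
  have hpi := Real.pi_pos
  have hanti : AntitoneOn (fun θ => ∫ x, F θ x ∂piGaussian κ) (Set.Icc 0 (Real.pi / 2)) := by
    refine antitoneOn_of_deriv_nonpos (convex_Icc _ _)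
      (fun θ _ => (hφ θ).continuousAt.continuousWithinAt)
      (fun θ _ => (hφ θ).differentiableAt.differentiableWithinAt) fun θ hθ => ?_
    rw [(hφ θ).deriv]
    rw [interior_Icc] at hθ
    refine hneg θ (mul_nonneg (Real.sin_nonneg_of_nonneg_of_le_pi hθ.1.le ?_)
      (Real.cos_nonneg_of_neg_pi_div_two_le_of_le ?_ hθ.2.le))
    · linarith [hθ.2]
    · linarith [hθ.1]
  have := hanti (Set.left_mem_Icc.2 (by positivity)) (Set.right_mem_Icc.2 (by positivity))
    (by positivity : (0 : ℝ) ≤ Real.pi / 2)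
  simpa [F, c] using this

end IsSmoothDescent

/-- A reflected smooth step. The width 1 is fixed, and the size of C is irrelevant because only
finiteness enters the comparison. -/
lemma exists_isSmoothDescent (s : ℝ) : ∃ ψ ψ' ψ'' : ℝ → ℝ, ∃ C, IsSmoothDescent ψ ψ' ψ'' C ∧
    (∀ x ≤ s, ψ x = 1) ∧ ∀ x, s + 1 ≤ x → ψ x = 0 := by
  have hS : ContDiff ℝ 2 Real.smoothTransition := Real.smoothTransition.contDiff (n := 2)
  have hS1 : ContDiff ℝ 1 (deriv Real.smoothTransition) :=
    ((contDiff_succ_iff_deriv (n := 1)).1 hS).2.2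
  have hS2 : Continuous (deriv (deriv Real.smoothTransition)) :=
    hS1.continuous_deriv le_rfl
  have hd (x : ℝ) : HasDerivAt Real.smoothTransition (deriv Real.smoothTransition x) x :=
    (hS.differentiable (by norm_num) x).hasDerivAt
  have hd1 (x : ℝ) : HasDerivAt (deriv Real.smoothTransition)
      (deriv (deriv Real.smoothTransition) x) x :=
    (hS1.differentiable (by norm_num) x).hasDerivAt
  -- The step is constant outside [0, 1], so both derivatives have compact support and are therefore
  -- bounded.
  have hcs : HasCompactSupport (deriv Real.smoothTransition) := by
    refine HasCompactSupport.intro (isCompact_Icc (a := (0 : ℝ)) (b := 1)) fun x hx => ?_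
    rw [Set.mem_Icc, not_and_or, not_le, not_le] at hx
    rcases hx with hx | hx
    · have : Real.smoothTransition =ᶠ[nhds x] fun _ => 0 := by
        filter_upwards [Iio_mem_nhds hx] with y hy
        exact Real.smoothTransition.zero_of_nonpos (le_of_lt hy)
      rw [this.deriv_eq, deriv_const]
    · have : Real.smoothTransition =ᶠ[nhds x] fun _ => 1 := by
        filter_upwards [Ioi_mem_nhds hx] with y hy
        exact Real.smoothTransition.one_of_one_le (le_of_lt hy)
      rw [this.deriv_eq, deriv_const]
  obtain ⟨C₁, hC₁⟩ := hcs.exists_bound_of_continuous hS1.continuous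
  obtain ⟨C₂, hC₂⟩ := hcs.deriv.exists_bound_of_continuous hS2
  have hsub (x : ℝ) : HasDerivAt (fun x => s + 1 - x) (-1) x := (hasDerivAt_id' x).const_sub _
  refine ⟨fun x => Real.smoothTransition (s + 1 - x),
    fun x => -deriv Real.smoothTransition (s + 1 - x),
    fun x => deriv (deriv Real.smoothTransition) (s + 1 - x), max C₁ C₂,
    ⟨fun x => ?_, fun x => ?_, by fun_prop, fun x => Real.smoothTransition.nonneg _,
      fun x => Real.smoothTransition.le_one _, fun x => ?_, fun x => ?_, fun x => ?_⟩,
      fun x hx => ?_, fun x hx => ?_⟩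
  · exact ((hd _).comp x (hsub x)).congr_deriv (by ring)
  · exact ((hd1 _).comp x (hsub x)).neg.congr_deriv (by ring)
  · exact neg_nonpos.2 Real.smoothTransition.monotone.deriv_nonneg
  · rw [abs_neg]; exact (hC₁ _).trans (le_max_left _ _)
  · exact (hC₂ _).trans (le_max_right _ _)
  · exact Real.smoothTransition.one_of_one_le (by linarith)
  · exact Real.smoothTransition.zero_of_nonpos (by linarith)

/-! ### From smooth functionals to probabilities -/

lemma measurePreserving_sum_piGaussian (κ κ' : Type*) [Fintype κ] [Fintype κ'] :
    MeasurePreserving (MeasurableEquiv.sumPiEquivProdPi fun _ : κ ⊕ κ' => ℝ)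
      (piGaussian (κ ⊕ κ')) ((piGaussian κ).prod (piGaussian κ')) :=
  measurePreserving_sumPiEquivProdPi fun _ : κ ⊕ κ' => gaussianReal 0 1

lemma measurePreserving_inl_piGaussian (κ κ' : Type*) [Fintype κ] [Fintype κ'] :
    MeasurePreserving (fun (x : κ ⊕ κ' → ℝ) i => x (Sum.inl i))
      (piGaussian (κ ⊕ κ')) (piGaussian κ) :=
  measurePreserving_fst.comp (measurePreserving_sum_piGaussian κ κ')

lemma measurePreserving_inr_piGaussian (κ κ' : Type*) [Fintype κ] [Fintype κ'] :
    MeasurePreserving (fun (x : κ ⊕ κ' → ℝ) i => x (Sum.inr i))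
      (piGaussian (κ ⊕ κ')) (piGaussian κ') :=
  measurePreserving_snd.comp (measurePreserving_sum_piGaussian κ κ')


/-- Slepian's inequality for the probability that one of finitely many Gaussian variables is large,
with a unit margin in the level. -/
lemma measureReal_exists_le_dotProduct_le {ι κ κ' : Type*} [Fintype ι] [Fintype κ] [Fintype κ']
    (a : ι → κ → ℝ) (b : ι → κ' → ℝ) (heq : ∀ i, a i ⬝ᵥ a i = b i ⬝ᵥ b i)
    (hle : ∀ i j, b i ⬝ᵥ b j ≤ a i ⬝ᵥ a j) (s : ℝ) :
    (piGaussian κ).real {x | ∃ i, s + 1 ≤ a i ⬝ᵥ x} ≤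
      (piGaussian κ').real {y | ∃ i, s < b i ⬝ᵥ y} := by
  obtain ⟨ψ, ψ', ψ'', C, h, h1, h0⟩ := exists_isSmoothDescent s
  have hψ := h.continuous
  -- Padding by zero puts the two families on independent blocks of coordinates, which gives the
  -- orthogonality needed for the path.
  have key := h.integral_prod_le_of_dotProduct_le (κ := κ ⊕ κ')
    (fun i => Sum.elim (a i) 0) (fun i => Sum.elim 0 (b i)) (by simp [dotProduct])
    (by simpa [dotProduct] using heq) (by simpa [dotProduct] using hle)
  have ha : ∫ x, ∏ i, ψ (Sum.elim (a i) 0 ⬝ᵥ x) ∂piGaussian (κ ⊕ κ') =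
      ∫ x, ∏ i, ψ (a i ⬝ᵥ x) ∂piGaussian κ := by
    have hmp := measurePreserving_inl_piGaussian κ κ'
    rw [← hmp.map_eq, integral_map hmp.measurable.aemeasurable
      (Continuous.aestronglyMeasurable (by fun_prop))]
    simp [dotProduct]
  have hb : ∫ x, ∏ i, ψ (Sum.elim 0 (b i) ⬝ᵥ x) ∂piGaussian (κ ⊕ κ') =
      ∫ x, ∏ i, ψ (b i ⬝ᵥ x) ∂piGaussian κ' := by
    have hmp := measurePreserving_inr_piGaussian κ κ'
    rw [← hmp.map_eq, integral_map hmp.measurable.aemeasurable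
      (Continuous.aestronglyMeasurable (by fun_prop))]
    simp [dotProduct]
  rw [ha, hb] at key
  have mA : MeasurableSet {x : κ → ℝ | ∃ i, s + 1 ≤ a i ⬝ᵥ x} := by
    rw [Set.ofPred_exists]
    exact .iUnion fun i => measurableSet_le measurable_const
      (Continuous.measurable (by fun_prop))
  have mB : MeasurableSet {x : κ' → ℝ | ∃ i, s < b i ⬝ᵥ x} := by
    rw [Set.ofPred_exists]
    exact .iUnion fun i => measurableSet_lt measurable_const
      (Continuous.measurable (by fun_prop))
  -- The product of cut-offs vanishes once some variable reaches s + 1 and equals 1 when all are at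
  -- most s; hence the unit margin.
  have lA : ∫ x, ∏ i, ψ (a i ⬝ᵥ x) ∂piGaussian κ ≤
      (piGaussian κ).real {x | ∃ i, s + 1 ≤ a i ⬝ᵥ x}ᶜ := by
    rw [← integral_indicator_one mA.compl]
    refine integral_mono (.of_bound (Continuous.aestronglyMeasurable (by fun_prop)) 1
      (.of_forall fun x => h.abs_prod_le_one _ _))
      ((integrable_const 1).indicator mA.compl) fun x => ?_
    by_cases hx : ∃ i, s + 1 ≤ a i ⬝ᵥ x
    · obtain ⟨i, hi⟩ := hx
      have h2 : ∏ i, ψ (a i ⬝ᵥ x) = 0 := Finset.prod_eq_zero (Finset.mem_univ i) (h0 _ hi)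
      simp only [h2]
      exact Set.indicator_nonneg (fun _ _ => zero_le_one) _
    · rw [Set.indicator_of_mem (by simpa using hx)]
      exact h.prod_le_one _ _
  have lB : (piGaussian κ').real {x | ∃ i, s < b i ⬝ᵥ x}ᶜ ≤
      ∫ x, ∏ i, ψ (b i ⬝ᵥ x) ∂piGaussian κ' := by
    rw [← integral_indicator_one mB.compl]
    refine integral_mono ((integrable_const 1).indicator mB.compl)
      (.of_bound (Continuous.aestronglyMeasurable (by fun_prop)) 1
      (.of_forall fun x => h.abs_prod_le_one _ _)) fun x => ?_
    by_cases hx : ∃ i, s < b i ⬝ᵥ x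
    · rw [Set.indicator_of_notMem (by simpa using hx)]
      exact h.prod_nonneg _ _
    · rw [Set.indicator_of_mem (by simpa using hx)]
      push Not at hx
      simp [h1 _ (hx _)]
  rw [probReal_compl_eq_one_sub mA] at lA
  rw [probReal_compl_eq_one_sub mB] at lB
  linarith

/-! ### Bilinear against linear Gaussian processes -/

lemma half_le_gaussianReal_Ici : 1 / 2 ≤ (gaussianReal 0 1).real (Set.Ici 0) := by
  have h1 : (gaussianReal 0 1).real (Set.Iic 0) = (gaussianReal 0 1).real (Set.Ici 0) := by
    have h := gaussianReal_map_neg (μ := 0) (v := 1)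
    rw [neg_zero] at h
    conv_lhs => rw [← h]
    rw [map_measureReal_apply measurable_neg measurableSet_Iic]
    congr 1
    ext x
    simp
  have h2 := measureReal_union_le (μ := gaussianReal 0 1) (Set.Iic (0 : ℝ)) (Set.Ici 0)
  rw [Set.Iic_union_Ici, probReal_univ] at h2
  linarith

lemma dotProduct_le_one_of_unit {κ : Type*} [Fintype κ] {u v : κ → ℝ} (hu : u ⬝ᵥ u = 1)
    (hv : v ⬝ᵥ v = 1) : u ⬝ᵥ v ≤ 1 := by
  have h : 0 ≤ (u - v) ⬝ᵥ (u - v) := Finset.sum_nonneg fun i _ => mul_self_nonneg _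
  simp only [sub_dotProduct, dotProduct_sub, hu, hv, dotProduct_comm v u] at h
  linarith

/-- Comparison of the bilinear Gaussian process `uᵀ G v` with the linear one `⟨g, u⟩ + ⟨h, v⟩`
over finitely many pairs of unit vectors. -/
lemma measureReal_exists_bilin_le {ι α β : Type*} [Fintype ι] [Fintype α] [Fintype β]
    (u : ι → α → ℝ) (v : ι → β → ℝ) (hu : ∀ i, u i ⬝ᵥ u i = 1) (hv : ∀ i, v i ⬝ᵥ v i = 1)
    (s : ℝ) :
    (piGaussian (α × β)).real {x | ∃ i, s + 1 ≤ ∑ p : α × β, u i p.1 * v i p.2 * x p} ≤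
      2 * (piGaussian (α ⊕ β)).real {y | ∃ i, s < Sum.elim (u i) (v i) ⬝ᵥ y} := by
  -- The extra `Unit` coordinate is the scalar γ, which raises each variance from 1 to 2 to match
  -- that of `b`.
  set a : ι → (α × β) ⊕ Unit → ℝ := fun i => Sum.elim (fun p => u i p.1 * v i p.2) 1
  set b : ι → α ⊕ β → ℝ := fun i => Sum.elim (u i) (v i)
  have ha : ∀ i j, a i ⬝ᵥ a j = (u i ⬝ᵥ u j) * (v i ⬝ᵥ v j) + 1 := by
    intro i j
    simp only [a, dotProduct, Fintype.sum_sum_type, Sum.elim_inl, Sum.elim_inr, Pi.one_apply,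
      mul_one, Finset.univ_unique, Finset.sum_const, Finset.card_singleton, one_smul,
      Finset.sum_mul_sum, Fintype.sum_prod_type]
    congr 1
    exact Finset.sum_congr rfl fun _ _ => Finset.sum_congr rfl fun _ _ => by ring
  have hb : ∀ i j, b i ⬝ᵥ b j = u i ⬝ᵥ u j + v i ⬝ᵥ v j := by
    intro i j
    simp [b, dotProduct]
  have key := measureReal_exists_le_dotProduct_le a b
    (by intro i; rw [ha, hb, hu, hv]; norm_num)
    (by
      intro i j
      rw [ha, hb]
      -- This is (1 − ⟨u, u'⟩)(1 − ⟨v, v'⟩) ≥ 0.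
      nlinarith [dotProduct_le_one_of_unit (hu i) (hu j),
        dotProduct_le_one_of_unit (hv i) (hv j)]) s
  refine le_trans ?_ (mul_le_mul_of_nonneg_left key zero_le_two)
  set E : Set (α × β → ℝ) := {x | ∃ i, s + 1 ≤ ∑ p : α × β, u i p.1 * v i p.2 * x p}
  have mE : MeasurableSet E := by
    simp only [E]
    rw [Set.ofPred_exists]
    exact .iUnion fun i => measurableSet_le measurable_const
      (Continuous.measurable (by fun_prop))
  -- On the independent event γ ≥ 0, adding γ keeps the process above the level.
  have hprod : (piGaussian (α × β)).real E * (gaussianReal 0 1).real (Set.Ici 0) ≤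
      (piGaussian ((α × β) ⊕ Unit)).real {x | ∃ i, s + 1 ≤ a i ⬝ᵥ x} := by
    have hmp := measurePreserving_sum_piGaussian (α × β) Unit
    have hev := measurePreserving_eval (fun _ : Unit => gaussianReal 0 1) ()
    have m1 : MeasurableSet (Function.eval () ⁻¹' Set.Ici 0 : Set (Unit → ℝ)) :=
      hev.measurable measurableSet_Ici
    rw [← hev.measureReal_preimage measurableSet_Ici.nullMeasurableSet, ← measureReal_prod_prod,
      ← hmp.measureReal_preimage (mE.prod m1).nullMeasurableSet]
    refine measureReal_mono ?_
    rintro x ⟨⟨i, hi⟩, hx⟩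
    refine ⟨i, hi.trans ?_⟩
    simp only [Set.mem_preimage, Set.mem_Ici] at hx
    simp only [a, dotProduct, Fintype.sum_sum_type, Sum.elim_inl, Sum.elim_inr, Pi.one_apply,
      one_mul, Finset.univ_unique, Finset.sum_singleton]
    exact le_add_of_nonneg_right hx
  nlinarith [half_le_gaussianReal_Ici, measureReal_nonneg (μ := piGaussian (α × β)) (s := E)]

/-! ### Chernoff bound for norms of Gaussian vectors -/

lemma integral_exp_mul_sq_gaussianReal {c : ℝ} (hc : c < 1 / 2) :
    ∫ x, Real.exp (c * x ^ 2) ∂gaussianReal 0 1 = (√(1 - 2 * c))⁻¹ := by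
  rw [integral_gaussianReal_eq_integral_smul one_ne_zero]
  have h : ∀ x : ℝ, gaussianPDFReal 0 1 x • Real.exp (c * x ^ 2) =
      (√(2 * Real.pi))⁻¹ * Real.exp (-(1 / 2 - c) * x ^ 2) := by
    intro x
    rw [gaussianPDFReal, NNReal.coe_one, smul_eq_mul, mul_assoc, ← Real.exp_add, mul_one]
    congr 2
    ring
  simp only [h]
  rw [integral_const_mul, integral_gaussian, ← Real.sqrt_inv, ← Real.sqrt_mul (by positivity),
    ← Real.sqrt_inv]
  congr 1
  have : (1 : ℝ) - 2 * c ≠ 0 := by linarith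
  have h2 : (1 : ℝ) / 2 - c ≠ 0 := by linarith
  have := Real.pi_ne_zero
  field_simp

lemma integrable_exp_mul_sq_gaussianReal {c : ℝ} (hc : c < 1 / 2) :
    Integrable (fun x => Real.exp (c * x ^ 2)) (gaussianReal 0 1) := by
  -- A non-integrable function has Bochner integral 0, so the nonzero value just computed proves
  -- integrability.
  refine .of_integral_ne_zero ?_
  rw [integral_exp_mul_sq_gaussianReal hc]
  have : 0 < 1 - 2 * c := by linarith
  positivity

/-- The tangent line to the concave square root at Q = a². It reduces exponential moments of a norm
to those of its square. -/
lemma mul_sqrt_le_mul_sq_add {r a Q : ℝ} (hr : 0 ≤ r) (ha : 0 < a) (hQ : 0 ≤ Q) :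
    r * √Q ≤ r * a / 2 + r / (2 * a) * Q := by
  have h : 0 ≤ r / (2 * a) * (√Q - a) ^ 2 := by positivity
  have h2 : r / (2 * a) * (√Q - a) ^ 2 = r / (2 * a) * (√Q) ^ 2 - r * √Q + r * a / 2 := by
    field_simp
    ring
  rw [Real.sq_sqrt hQ] at h2
  linarith

/-- With `a = √n + r`, the moment generating function of a chi-squared variable with `n` degrees of
freedom at `r / (2 a)` is at most `exp (r √n / 2)`. -/
lemma inv_sqrt_pow_le_exp {n : ℕ} (hn : 0 < n) {r : ℝ} (hr : 0 ≤ r) :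
    (√(1 - 2 * (r / (2 * (√n + r)))))⁻¹ ^ n ≤ Real.exp (r * √n / 2) := by
  have hs : 0 < √(n : ℝ) := by positivity
  have h1 : 1 - 2 * (r / (2 * (√n + r))) = (1 + r / √n)⁻¹ := by
    have : √(n : ℝ) + r ≠ 0 := by positivity
    field_simp
    ring
  have h2 : (√(1 - 2 * (r / (2 * (√n + r)))))⁻¹ ≤ Real.exp (r / √n / 2) := by
    rw [h1, Real.sqrt_inv, inv_inv, Real.exp_half]
    refine Real.sqrt_le_sqrt ?_
    linarith [Real.add_one_le_exp (r / √n)]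
  refine (pow_le_pow_left₀ (by positivity) h2 n).trans_eq ?_
  rw [← Real.exp_nat_mul]
  congr 1
  have h3 : (n : ℝ) = √n * √n := (Real.mul_self_sqrt (Nat.cast_nonneg n)).symm
  nth_rewrite 1 [h3]
  field_simp

/-- Chernoff bound for the sum of the norms of two independent standard normal vectors. -/
lemma measureReal_lt_sqrt_add_sqrt_le {n d : ℕ} (hn : 0 < n) (hd : 0 < d) {t : ℝ} (ht : 0 ≤ t) :
    (piGaussian (Fin n ⊕ Fin d)).real {y | √n + √d + t <
      √(∑ i, y (Sum.inl i) ^ 2) + √(∑ j, y (Sum.inr j) ^ 2)} ≤ Real.exp (-t ^ 2 / 4) := by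
  -- The Chernoff exponent comes out as r² − rt, which is least at r = t/2.
  set r := t / 2 with hr
  have hr0 : 0 ≤ r := by positivity
  set a := √(n : ℝ) + r
  set a' := √(d : ℝ) + r
  have ha : 0 < a := by positivity
  have ha' : 0 < a' := by positivity
  set q : Fin n ⊕ Fin d → ℝ := Sum.elim (fun _ => r / (2 * a)) fun _ => r / (2 * a')
  have hq1 : r / (2 * a) < 1 / 2 := by
    rw [div_lt_div_iff₀ (by positivity) two_pos]
    have : 0 < √(n : ℝ) := by positivity
    linarith
  have hq2 : r / (2 * a') < 1 / 2 := by
    rw [div_lt_div_iff₀ (by positivity) two_pos]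
    have : 0 < √(d : ℝ) := by positivity
    linarith
  have hq : ∀ k, q k < 1 / 2 := by rintro (k | k) <;> assumption
  set W : (Fin n ⊕ Fin d → ℝ) → ℝ := fun y => ∏ k, Real.exp (q k * y k ^ 2)
  have iW : Integrable W (piGaussian (Fin n ⊕ Fin d)) :=
    Integrable.fintype_prod (f := fun k x => Real.exp (q k * x ^ 2))
      fun k => integrable_exp_mul_sq_gaussianReal (hq k)
  have hW : ∫ y, W y ∂piGaussian (Fin n ⊕ Fin d) ≤ Real.exp (r * √n / 2 + r * √d / 2) := by
    rw [integral_fintype_prod_eq_prod (f := fun k x => Real.exp (q k * x ^ 2)),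
      Fintype.prod_sum_type, Real.exp_add]
    simp only [integral_exp_mul_sq_gaussianReal (hq _)]
    simp only [q, Sum.elim_inl, Sum.elim_inr, Finset.prod_const, Finset.card_univ,
      Fintype.card_fin]
    exact mul_le_mul (inv_sqrt_pow_le_exp hn hr0) (inv_sqrt_pow_le_exp hd hr0) (by positivity)
      (by positivity)
  -- The value that the tangent-line bounds force `W` to exceed on the event; Markov's inequality is
  -- applied at this level.
  set ε := Real.exp (r * (√n + √d + t) - r * a / 2 - r * a' / 2) with hε
  have hsub : {y : Fin n ⊕ Fin d → ℝ | √n + √d + t <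
      √(∑ i, y (Sum.inl i) ^ 2) + √(∑ j, y (Sum.inr j) ^ 2)} ⊆ {y | ε ≤ W y} := by
    intro y hy
    rw [Set.mem_ofPred_eq] at hy ⊢
    simp only [W, hε]
    rw [← Real.exp_sum, Real.exp_le_exp, Fintype.sum_sum_type]
    simp only [q, Sum.elim_inl, Sum.elim_inr, ← Finset.mul_sum]
    have h1 := mul_sqrt_le_mul_sq_add hr0 ha
      (Q := ∑ i, y (Sum.inl i) ^ 2) (by positivity)
    have h2 := mul_sqrt_le_mul_sq_add hr0 ha'
      (Q := ∑ j, y (Sum.inr j) ^ 2) (by positivity)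
    have h3 := mul_le_mul_of_nonneg_left hy.le hr0
    rw [mul_add r (√(∑ i, y (Sum.inl i) ^ 2))] at h3
    linarith
  have hmk := mul_meas_ge_le_integral_of_nonneg (μ := piGaussian (Fin n ⊕ Fin d))
    (.of_forall fun y => Finset.prod_nonneg fun k _ => (Real.exp_pos _).le) iW ε
  refine (measureReal_mono hsub).trans ?_
  have hε0 : 0 < ε := Real.exp_pos _
  rw [← mul_le_mul_iff_right₀ hε0]
  refine hmk.trans (hW.trans_eq ?_)
  rw [hε, ← Real.exp_add]
  congr 1
  simp only [a, a', hr]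
  ring

/-! ### Spectral norms and centering -/

lemma dotProduct_le_sqrt_of_unit {κ : Type*} [Fintype κ] {u : κ → ℝ} (hu : u ⬝ᵥ u = 1)
    (y : κ → ℝ) : u ⬝ᵥ y ≤ √(∑ i, y i ^ 2) := by
  refine Real.le_sqrt_of_sq_le ?_
  have h := Finset.sum_mul_sq_le_sq_mul_sq Finset.univ u y
  simp only [dotProduct, ← sq] at hu
  rwa [hu, one_mul] at h

lemma norm_le_of_unit_bilin_le {m n : ℕ} {A : Matrix (Fin m) (Fin n) ℝ} {R : ℝ} (hR : 0 ≤ R)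
    (h : ∀ (u : EuclideanSpace ℝ (Fin m)) (v : EuclideanSpace ℝ (Fin n)), ‖u‖ = 1 → ‖v‖ = 1 →
      u.ofLp ⬝ᵥ A *ᵥ v.ofLp ≤ R) : ‖A‖ ≤ R := by
  rw [l2_opNorm_def]
  refine ContinuousLinearMap.opNorm_le_of_unit_norm hR fun v hv => ?_
  set w := (toEuclideanLin.trans LinearMap.toContinuousLinearMap A) v with hw
  have hwv : w.ofLp = A *ᵥ v.ofLp := rfl
  rcases eq_or_ne w 0 with h0 | h0
  · simpa [h0] using hR
  have hn : ‖w‖ ≠ 0 := norm_ne_zero_iff.2 h0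
  -- The optimal left vector for a given v is Av normalized.
  have h1 := h (‖w‖⁻¹ • w) v (by rw [norm_smul, norm_inv, norm_norm, inv_mul_cancel₀ hn]) hv
  have h2 : w.ofLp ⬝ᵥ w.ofLp = ‖w‖ ^ 2 := by
    rw [EuclideanSpace.real_norm_sq_eq]
    simp [dotProduct, sq]
  rw [← hwv, WithLp.ofLp_smul, smul_dotProduct, h2, smul_eq_mul] at h1
  convert h1 using 1
  field_simp

lemma norm_le_norm_of_sum_mulVec_sq_le {m n : ℕ} {A B : Matrix (Fin m) (Fin n) ℝ}
    (h : ∀ v, ∑ i, (A *ᵥ v) i ^ 2 ≤ ∑ i, (B *ᵥ v) i ^ 2) : ‖A‖ ≤ ‖B‖ := by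
  rw [l2_opNorm_def A]
  refine ContinuousLinearMap.opNorm_le_bound _ (norm_nonneg _) fun v => ?_
  refine le_trans ?_ (l2_opNorm_mulVec B v)
  rw [EuclideanSpace.norm_eq, EuclideanSpace.norm_eq]
  refine Real.sqrt_le_sqrt ?_
  simp only [Real.norm_eq_abs, sq_abs]
  exact h v.ofLp

/-- Subtracting the mean c lowers the sum of squares by exactly n c². -/
lemma sum_sub_mean_sq_le {n : ℕ} (w : Fin n → ℝ) :
    ∑ i, (w i - 1 / (n : ℝ) * ∑ j, w j) ^ 2 ≤ ∑ i, w i ^ 2 := by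
  rcases Nat.eq_zero_or_pos n with rfl | hn
  · simp
  have hn' : (n : ℝ) ≠ 0 := by positivity
  set c := 1 / (n : ℝ) * ∑ j, w j with hc
  have h : ∑ j, w j = n * c := by rw [hc]; field_simp
  have h2 : ∑ i, (w i - c) ^ 2 = ∑ i, w i ^ 2 - n * c ^ 2 := by
    simp only [sub_sq, Finset.sum_add_distrib, Finset.sum_sub_distrib, ← Finset.sum_mul,
      ← Finset.mul_sum, h, Finset.sum_const, Finset.card_univ, Fintype.card_fin, nsmul_eq_mul]
    ring
  rw [h2]
  have : 0 ≤ (n : ℝ) * c ^ 2 := by positivity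
  linarith

/-- Centering removes the mean and does not increase the spectral norm. -/
lemma norm_centeredData_le {n d : ℕ} (hn : 0 < n) (X : Matrix (Fin n) (Fin d) ℝ) (μ : Fin d → ℝ) :
    ‖centeredData X‖ ≤ ‖(Matrix.of fun i j => X i j - μ j : Matrix (Fin n) (Fin d) ℝ)‖ := by
  refine norm_le_norm_of_sum_mulVec_sq_le fun v => ?_
  set G : Matrix (Fin n) (Fin d) ℝ := Matrix.of fun i j => X i j - μ j
  have hn' : (n : ℝ) ≠ 0 := by positivity
  have h : ∀ i, (centeredData X *ᵥ v) i = (G *ᵥ v) i - 1 / (n : ℝ) * ∑ j, (G *ᵥ v) j := by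
    intro i
    have hG : ∀ i, (G *ᵥ v) i = X i ⬝ᵥ v - μ ⬝ᵥ v := fun i => sub_dotProduct (X i) μ v
    have hs : sampleMean X ⬝ᵥ v = 1 / (n : ℝ) * ∑ j, X j ⬝ᵥ v := by
      rw [sampleMean, smul_dotProduct, sum_dotProduct, smul_eq_mul]
      rfl
    have hZ : (centeredData X *ᵥ v) i = X i ⬝ᵥ v - sampleMean X ⬝ᵥ v :=
      sub_dotProduct (X i) (sampleMean X) v
    simp only [hZ, hG, hs, Finset.sum_sub_distrib, Finset.sum_const, Finset.card_univ,
      Fintype.card_fin, nsmul_eq_mul]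
    field_simp
    ring
  simp only [h]
  exact sum_sub_mean_sq_le _

/-- The identity ‖ZᵀZ‖ = ‖Z‖² makes the claim deterministic once ‖G‖ is bounded. -/
lemma norm_sampleCovariance_le {n d : ℕ} (hn : 0 < n) (X : Matrix (Fin n) (Fin d) ℝ)
    (μ : Fin d → ℝ) {t : ℝ}
    (h : ‖(Matrix.of fun i j => X i j - μ j : Matrix (Fin n) (Fin d) ℝ)‖ ≤ √n + √d + t) :
    ‖sampleCovariance X‖ ≤ (1 + √((d : ℝ) / (n : ℝ)) + t / √(n : ℝ)) ^ 2 := by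
  have hZ := (norm_centeredData_le hn X μ).trans h
  have hs : 0 < √(n : ℝ) := by positivity
  have h1 : 1 + √((d : ℝ) / (n : ℝ)) + t / √(n : ℝ) = (√n + √d + t) / √n := by
    rw [Real.sqrt_div (Nat.cast_nonneg d)]
    field_simp
  rw [sampleCovariance, norm_smul, ← conjTranspose_eq_transpose_of_trivial,
    l2_opNorm_conjTranspose_mul_self, h1, div_pow, Real.sq_sqrt (Nat.cast_nonneg n),
    Real.norm_of_nonneg (by positivity), ← sq, one_div, inv_mul_eq_div]
  gcongr

/-! ### The Gaussian matrix and its tail -/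

/-- The entries of a matrix with independent `N(μ, I)` rows, after subtracting `μ`, are
independent standard normal variables. -/
lemma map_entries_eq_piGaussian {Ω : Type*} [MeasurableSpace Ω] {P : Measure Ω}
    [IsProbabilityMeasure P] {n d : ℕ} {μ : EuclideanSpace ℝ (Fin d)}
    {X : Ω → Matrix (Fin n) (Fin d) ℝ}
    (hlaw : ∀ i : Fin n,
      HasLaw (fun ω => WithLp.toLp 2 ((X ω).row i)) (multivariateGaussian μ 1) P)
    (hindep : iIndepFun (fun (i : Fin n) ω => WithLp.toLp 2 ((X ω).row i)) P) :
    AEMeasurable (fun ω (p : Fin n × Fin d) => X ω p.1 p.2 - μ p.2) P ∧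
      P.map (fun ω (p : Fin n × Fin d) => X ω p.1 p.2 - μ p.2) = piGaussian (Fin n × Fin d) := by
  set Y : Ω → Fin n → EuclideanSpace ℝ (Fin d) := fun ω i => WithLp.toLp 2 ((X ω).row i)
  set Ψ : (Fin n → EuclideanSpace ℝ (Fin d)) → Fin n × Fin d → ℝ := fun y p => y p.1 p.2 - μ p.2
  set Φ : (Fin n → Fin d → ℝ) → Fin n → EuclideanSpace ℝ (Fin d) :=
    fun x i => μ + WithLp.toLp 2 (x i)
  have mΨ : Measurable Ψ := by fun_prop
  have mΦ : Measurable Φ := by fun_prop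
  have mY : AEMeasurable Y P := aemeasurable_pi_lambda _ fun i => (hlaw i).aemeasurable
  have hY : P.map Y = Measure.pi fun _ => multivariateGaussian μ 1 := by
    rw [iIndepFun.map_fun_eq_pi_map (fun i => (hlaw i).aemeasurable) hindep]
    simp only [(hlaw _).map_eq]
  have hmg : multivariateGaussian μ 1 =
      (piGaussian (Fin d)).map (fun z => μ + WithLp.toLp 2 z) := by
    rw [multivariateGaussian, ← map_pi_eq_stdGaussian, Measure.map_map (by fun_prop) (by fun_prop)]
    simp [Function.comp_def]
  have hΦ : (Measure.pi fun _ : Fin n => piGaussian (Fin d)).map Φ =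
      Measure.pi fun _ => multivariateGaussian μ 1 := by
    have : IsProbabilityMeasure ((piGaussian (Fin d)).map fun z => μ + WithLp.toLp 2 z) := by
      rw [← hmg]; infer_instance
    simp only [hmg]
    exact Measure.pi_map_pi (μ := fun _ : Fin n => piGaussian (Fin d))
      (f := fun _ z => μ + WithLp.toLp 2 z) fun _ => Measurable.aemeasurable (by fun_prop)
  have hcurry : (Measure.pi fun _ : Fin n => piGaussian (Fin d)).map
      (MeasurableEquiv.curry (Fin n) (Fin d) ℝ).symm = piGaussian (Fin n × Fin d) := by
    have := Measure.infinitePi_map_curry_symm fun (_ : Fin n) (_ : Fin d) => gaussianReal 0 1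
    simpa only [Measure.infinitePi_eq_pi] using this
  refine ⟨mΨ.comp_aemeasurable mY, ?_⟩
  calc P.map (Ψ ∘ Y) = (P.map Y).map Ψ := (AEMeasurable.map_map_of_aemeasurable
        mΨ.aemeasurable mY).symm
    _ = (Measure.pi fun _ : Fin n => piGaussian (Fin d)).map (Ψ ∘ Φ) := by
        rw [hY, ← hΦ, Measure.map_map mΨ mΦ]
    _ = piGaussian (Fin n × Fin d) := by
        rw [← hcurry]
        congr 1
        ext x p
        simp [Ψ, Φ, MeasurableEquiv.curry, Function.uncurry]

/-- Tail bound for the spectral norm of a Gaussian matrix. -/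
lemma measure_lt_norm_le {n d : ℕ} (hn : 0 < n) (hd : 0 < d) {t : ℝ} (ht : 0 ≤ t) :
    piGaussian (Fin n × Fin d) {x | √n + √d + (t + 1) <
      ‖(Matrix.of fun i j => x (i, j) : Matrix (Fin n) (Fin d) ℝ)‖} ≤
      ENNReal.ofReal (2 * Real.exp (-t ^ 2 / 4)) := by
  set S := Metric.sphere (0 : EuclideanSpace ℝ (Fin n)) 1 ×
    Metric.sphere (0 : EuclideanSpace ℝ (Fin d)) 1
  have : NeZero n := ⟨hn.ne'⟩
  have : NeZero d := ⟨hd.ne'⟩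
  have : Nonempty S := ⟨⟨EuclideanSpace.single 0 1, by simp⟩, ⟨EuclideanSpace.single 0 1, by simp⟩⟩
  -- Finite initial segments of a dense sequence replace an ε-net: their bounds do not depend on the
  -- cardinality, so the passage to the supremum costs nothing.
  set D := TopologicalSpace.denseSeq S
  set f : S → (Fin n × Fin d → ℝ) → ℝ := fun q x => ∑ p : Fin n × Fin d,
    (q.1.1.ofLp p.1) * (q.2.1.ofLp p.2) * x p
  set E : ℕ → Set (Fin n × Fin d → ℝ) := fun k =>
    {x | ∃ i : Fin k, √n + √d + t + 1 ≤ f (D i) x}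
  have hE : Monotone E := by
    rintro k l hkl x ⟨i, hi⟩
    exact ⟨Fin.castLE hkl i, hi⟩
  have hunit : ∀ {m : ℕ} (u : Metric.sphere (0 : EuclideanSpace ℝ (Fin m)) 1),
      u.1.ofLp ⬝ᵥ u.1.ofLp = 1 := by
    intro m u
    have h := EuclideanSpace.real_norm_sq_eq u.1
    rw [norm_eq_of_mem_sphere u, one_pow] at h
    simp only [dotProduct, ← sq]
    exact h.symm
  have hbound : ∀ k, piGaussian (Fin n × Fin d) (E k) ≤
      ENNReal.ofReal (2 * Real.exp (-t ^ 2 / 4)) := by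
    intro k
    rw [← ofReal_measureReal]
    refine ENNReal.ofReal_le_ofReal ((measureReal_exists_bilin_le
      (fun i : Fin k => (D i).1.1.ofLp) (fun i : Fin k => (D i).2.1.ofLp)
      (fun i => hunit _) (fun i => hunit _) _).trans (mul_le_mul_of_nonneg_left
      ((measureReal_mono ?_).trans (measureReal_lt_sqrt_add_sqrt_le hn hd ht)) zero_le_two))
    rintro y ⟨i, hi⟩
    refine hi.trans_le ?_
    simp only [dotProduct, Fintype.sum_sum_type, Sum.elim_inl, Sum.elim_inr]
    exact add_le_add (dotProduct_le_sqrt_of_unit (hunit (D i).1) fun i => y (Sum.inl i))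
      (dotProduct_le_sqrt_of_unit (hunit (D i).2) fun i => y (Sum.inr i))
  have hsub : {x : Fin n × Fin d → ℝ | √n + √d + (t + 1) <
      ‖(Matrix.of fun i j => x (i, j) : Matrix (Fin n) (Fin d) ℝ)‖} ⊆ ⋃ k, E k := by
    intro x hx
    rw [Set.mem_ofPred_eq] at hx
    have hex : ∃ q : S, √n + √d + t + 1 < f q x := by
      by_contra! hcon
      refine hx.not_ge (norm_le_of_unit_bilin_le (by positivity) fun u v hu hv => ?_)
      have h := hcon ⟨⟨u, by simpa using hu⟩, ⟨v, by simpa using hv⟩⟩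
      rw [← add_assoc]
      refine le_of_eq_of_le ?_ h
      simp only [f, dotProduct, mulVec, Fintype.sum_prod_type, Finset.mul_sum, of_apply]
      exact Finset.sum_congr rfl fun _ _ => Finset.sum_congr rfl fun _ _ => by ring
    have hcont : Continuous fun q : Metric.sphere (0 : EuclideanSpace ℝ (Fin n)) 1 ×
      Metric.sphere (0 : EuclideanSpace ℝ (Fin d)) 1 => f q x := by fun_prop
    -- The strict inequality defines a nonempty open set of pairs, which must contain a point of the
    -- dense sequence; index k first appears in segment k + 1.
    obtain ⟨q, hq, k, rfl⟩ := (TopologicalSpace.denseRange_denseSeq S).inter_open_nonempty _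
      (isOpen_lt continuous_const hcont) hex
    exact Set.mem_iUnion.2 ⟨k + 1, Fin.last k, le_of_lt hq⟩
  refine (measure_mono hsub).trans ?_
  rw [hE.measure_iUnion]
  exact iSup_le hbound

/-- The unit margin is absorbed here: 2(t − 1)² ≥ t² holds from t = 2 + √2 on. -/
lemma two_mul_exp_le_three_mul_exp {t : ℝ} (ht : 5 ≤ t) :
    2 * Real.exp (-(t - 1) ^ 2 / 4) ≤ 3 * Real.exp (-t ^ 2 / 8) :=
  mul_le_mul (by norm_num) (Real.exp_le_exp.2 (by nlinarith)) (Real.exp_pos _).le (by norm_num)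

end GaussianMatrix

/-- The rows of the random `n × d` matrix `X` are independent with law `N(μ, I)`. -/
theorem corollary2 {Ω : Type*} [MeasurableSpace Ω] (P : Measure Ω) [IsProbabilityMeasure P]
    (n d : ℕ) (μ : EuclideanSpace ℝ (Fin d)) (X : Ω → Matrix (Fin n) (Fin d) ℝ)
    (hlaw : ∀ i : Fin n,
      HasLaw (fun ω => WithLp.toLp 2 ((X ω).row i)) (multivariateGaussian μ 1) P)
    (hindep : iIndepFun (fun (i : Fin n) ω => WithLp.toLp 2 ((X ω).row i)) P)
    (hdn : (d : ℝ) / (n : ℝ) ≤ 16) (hn : 16 ≤ n) (t : ℝ) (ht : 5 ≤ t) :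
    1 - 3 * Real.exp (-t ^ 2 / 8) ≤
      P.real {ω | ‖sampleCovariance (X ω)‖ ≤
        (1 + √((d : ℝ) / (n : ℝ)) + t / √(n : ℝ)) ^ 2} := by
  have hn0 : 0 < n := by omega
  set A : Set Ω := {ω | ‖sampleCovariance (X ω)‖ ≤
    (1 + √((d : ℝ) / (n : ℝ)) + t / √(n : ℝ)) ^ 2}
  -- Subadditivity gives this direction without measurability of `A`.
  suffices h : P.real Aᶜ ≤ 3 * Real.exp (-t ^ 2 / 8) by
    have h1 := measureReal_union_le (μ := P) A Aᶜ
    rw [Set.union_compl_self, probReal_univ] at h1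
    linarith
  -- For d = 0 there are no unit vectors to take a supremum over, but the covariance matrix is zero.
  rcases Nat.eq_zero_or_pos d with rfl | hd
  · have hA : Aᶜ = ∅ := by
      rw [Set.compl_empty_iff, Set.eq_univ_iff_forall]
      intro ω
      have : ‖sampleCovariance (X ω)‖ = 0 := by
        rw [Subsingleton.elim (sampleCovariance (X ω)) 0, norm_zero]
      simp only [A, Set.mem_ofPred_eq, this]
      positivity
    rw [hA, measureReal_empty]
    positivity
  obtain ⟨hm, hmap⟩ := map_entries_eq_piGaussian hlaw hindep
  set B : Set (Fin n × Fin d → ℝ) := {x | √n + √d + (t - 1 + 1) <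
      ‖(Matrix.of fun i j => x (i, j) : Matrix (Fin n) (Fin d) ℝ)‖}
  have hsub : Aᶜ ⊆ (fun ω (p : Fin n × Fin d) => X ω p.1 p.2 - μ p.2) ⁻¹' B := by
    intro ω hω
    by_contra hB
    simp only [B, Set.mem_preimage, Set.mem_ofPred_eq, not_lt, sub_add_cancel] at hB
    exact hω (norm_sampleCovariance_le hn0 (X ω) μ.ofLp hB)
  have hP : P Aᶜ ≤ ENNReal.ofReal (2 * Real.exp (-(t - 1) ^ 2 / 4)) := by
    -- A preimage has outer measure at most that of the set under the image law, so `B` need not be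
    -- shown measurable.
    refine (measure_mono hsub).trans ((Measure.le_map_apply hm B).trans ?_)
    rw [hmap]
    exact measure_lt_norm_le hn0 hd (by linarith)
  exact (ENNReal.toReal_le_of_le_ofReal (by positivity) hP).trans (two_mul_exp_le_three_mul_exp ht)
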